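/- Let $\mathcal H$ be a Hilbert space over $\mathbb K\in\{\mathbb R,\mathbb C\}$ and let $H_0\colon D(H_0)\subseteq\mathcal H\to\mathcal H$ be a densely defined closed linear operator which is skew-symmetric, i.e. $H_0\subseteq -H_0^\star$. Then the following are equivalent. (i) There exists a skew-self-adjoint extension of $H_0$, i.e. a densely defined operator $H\supseteq H_0$ in $\mathcal H$ with $H=-H^\star$. (ii) The deficiency indices of $H_0$ are equal, i.e. $\dim\ker(1-H_0^\star)=\dim\ker(1+H_0^\star)$. (iii) There exists a boundary triplet for $H_0$, i.e. a triple $(\mathcal G,\Gamma_1,\Gamma_2)$ consisting of a Hilbert space $\mathcal G$ over $\mathbb K$ and linear maps $\Gamma_1,\Gamma_2\colon D(H_0^\star)\to\mathcal G$ such that $x\mapsto(\Gamma_1x,\Gamma_2x)$ maps $D(H_0^\star)$ onto $\mathcal G\oplus\mathcal G$ and $$(H_0^\star x,y)_{\mathcal H}+(x,H_0^\star y)_{\mathcal H}=(\Gamma_1x,\Gamma_2y)_{\mathcal G}+(\Gamma_2x,\Gamma_1y)_{\mathcal G}\quad\text{for all }x,y\in D(H_0^\star).$$ (iv) There exists a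 boundary system $(\Omega,\mathcal G_1,\mathcal G_2,F,\omega)$ for $H_0$ with $\dim\mathcal G_1=\dim\mathcal G_2$, where $\Omega$ is the standard symmetric form and $\omega$ is the standard unitary form. That is, there are Hilbert spaces $\mathcal G_1,\mathcal G_2$ over $\mathbb K$ with $\dim\mathcal G_1=\dim\mathcal G_2$ and a surjective map $F\colon\operatorname{Graph}(H_0^\star)\to\mathcal G_1\oplus\mathcal G_2$ such that $$\Omega\bigl((x,H_0^\star x),(y,H_0^\star y)\bigr)=\omega\bigl(F(x,H_0^\star x),F(y,H_0^\star y)\bigr)\quad\text{for all }x,y\in D(H_0^\star),$$ where $\Omega((x,y),(u,v))=(x,v)_{\mathcal H}+(y,u)_{\mathcal H}$ on $\mathcal H\oplus\mathcal H$ and $\omega((x,y),(u,v))=(x,u)_{\mathcal G_1}-(y,v)_{\mathcal G_2}$ on $\mathcal G_1\oplus\mathcal G_2$. Here $\dim$ denotes the Hilbert space dimension, i.e. the cardinality of an orthonormal basis. -/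

import Mathlib

open scoped LinearPMap ComplexConjugate

universe u v

namespace SkewExt

/-- The (Hilbert space) dimension: the least cardinality of an orthonormal (Hilbert) basis.
All Hilbert bases have the same cardinality, see `hilbertDim_eq`. -/
noncomputable def hilbertDim (𝕜 : Type v) (E : Type u) [RCLike 𝕜] [NormedAddCommGroup E]
    [InnerProductSpace 𝕜 E] : Cardinal.{u} :=
  sInf {c | ∃ (ι : Type u) (_ : HilbertBasis ι 𝕜 E), Cardinal.mk ι = c}

section dim

variable {𝕜 : Type v} {E : Type u} [RCLike 𝕜] [NormedAddCommGroup E] [InnerProductSpace 𝕜 E]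

theorem mk_le_of_infinite {ι κ : Type u} [Infinite ι] (b : HilbertBasis ι 𝕜 E)
    (c : HilbertBasis κ 𝕜 E) : Cardinal.mk κ ≤ Cardinal.mk ι := by
  have hcount : ∀ i, Set.Countable {k | inner 𝕜 (c k) (b i) ≠ 0} := by
    intro i
    have h := c.orthonormal.inner_products_summable (x := b i)
    refine h.countable_support.mono ?_
    intro k hk
    simpa using hk
  have hcov : (⋃ i, {k | inner 𝕜 (c k) (b i) ≠ 0}) = Set.univ := by
    refine Set.eq_univ_of_forall fun k => ?_
    by_contra hk
    simp only [Set.mem_iUnion, Set.mem_ofPred_eq, not_exists, not_not] at hk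
    have h0 : b.repr (c k) = 0 := by
      ext i
      rw [b.repr_apply_apply, ← inner_conj_symm, hk i]
      simp
    have h1 : c k = 0 := by simpa using h0
    have := c.orthonormal.1 k
    rw [h1] at this
    simp at this
  calc Cardinal.mk κ = Cardinal.mk (Set.univ : Set κ) := Cardinal.mk_univ.symm
    _ = Cardinal.mk (⋃ i, {k | inner 𝕜 (c k) (b i) ≠ 0}) := by rw [hcov]
    _ ≤ Cardinal.sum fun i => Cardinal.mk {k | inner 𝕜 (c k) (b i) ≠ 0} :=
        Cardinal.mk_iUnion_le_sum_mk
    _ ≤ Cardinal.sum fun _ : ι => Cardinal.aleph0 :=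
        Cardinal.sum_le_sum _ _ fun i => (hcount i).le_aleph0
    _ = Cardinal.mk ι * Cardinal.aleph0 := by simp
    _ = Cardinal.mk ι := Cardinal.mul_aleph0_eq (Cardinal.aleph0_le_mk ι)

theorem mk_eq_of_hilbertBasis {ι κ : Type u} (b : HilbertBasis ι 𝕜 E)
    (c : HilbertBasis κ 𝕜 E) : Cardinal.mk ι = Cardinal.mk κ := by
  rcases finite_or_infinite ι with hi | hi <;> rcases finite_or_infinite κ with hk | hk
  · have := Fintype.ofFinite ι
    have := Fintype.ofFinite κ
    exact mk_eq_mk_of_basis' b.toOrthonormalBasis.toBasis c.toOrthonormalBasis.toBasis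
  · have := Fintype.ofFinite ι
    have := b.toOrthonormalBasis.toBasis.finiteDimensional_of_finite
    exact absurd c.orthonormal.linearIndependent.finite (not_finite_iff_infinite.2 hk)
  · have := Fintype.ofFinite κ
    have := c.toOrthonormalBasis.toBasis.finiteDimensional_of_finite
    exact absurd b.orthonormal.linearIndependent.finite (not_finite_iff_infinite.2 hi)
  · exact le_antisymm (mk_le_of_infinite c b) (mk_le_of_infinite b c)

theorem hilbertDim_eq {ι : Type u} (b : HilbertBasis ι 𝕜 E) :
    hilbertDim 𝕜 E = Cardinal.mk ι := by
  obtain ⟨κ, c, hc⟩ := csInf_mem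
    (s := {c | ∃ (ι : Type u) (_ : HilbertBasis ι 𝕜 E), Cardinal.mk ι = c}) ⟨_, ι, b, rfl⟩
  rw [hilbertDim, ← hc]
  exact mk_eq_of_hilbertBasis c b

end dim

section operators

variable {𝕜 : Type v} {E : Type u} [RCLike 𝕜] [NormedAddCommGroup E] [InnerProductSpace 𝕜 E]

/-- `T` is skew-symmetric: `T ⊆ -T⋆`. -/
def IsSkewSymmetric [CompleteSpace E] (T : E →ₗ.[𝕜] E) : Prop :=
  T ≤ -T†

/-- `T` is skew-self-adjoint: it is densely defined and `T = -T⋆`. -/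
def IsSkewSelfAdjoint [CompleteSpace E] (T : E →ₗ.[𝕜] E) : Prop :=
  Dense (T.domain : Set E) ∧ T = -T†

/-- The subspace `ker (1 - T) = {x ∈ D(T) ; x - T x = 0}` of `E`. -/
def kerOneSub (T : E →ₗ.[𝕜] E) : Submodule 𝕜 E :=
  (LinearMap.ker (T.domain.subtype - T.toFun)).map T.domain.subtype

/-- The subspace `ker (1 + T) = {x ∈ D(T) ; x + T x = 0}` of `E`. -/
def kerOneAdd (T : E →ₗ.[𝕜] E) : Submodule 𝕜 E :=
  (LinearMap.ker (T.domain.subtype + T.toFun)).map T.domain.subtype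

theorem mem_kerOneSub {T : E →ₗ.[𝕜] E} {x : E} : x ∈ kerOneSub T ↔ (x, x) ∈ T.graph := by
  simp only [kerOneSub, Submodule.mem_map, LinearMap.mem_ker, LinearMap.sub_apply,
    Submodule.subtype_apply, LinearPMap.toFun_eq_coe, LinearPMap.mem_graph_iff, sub_eq_zero]
  exact ⟨fun ⟨y, h1, h2⟩ => ⟨y, h2, h1 ▸ h2⟩, fun ⟨y, h1, h2⟩ => ⟨y, h1.trans h2.symm, h1⟩⟩

theorem mem_kerOneAdd {T : E →ₗ.[𝕜] E} {x : E} : x ∈ kerOneAdd T ↔ (x, -x) ∈ T.graph := by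
  simp only [kerOneAdd, Submodule.mem_map, LinearMap.mem_ker, LinearMap.add_apply,
    Submodule.subtype_apply, LinearPMap.toFun_eq_coe, LinearPMap.mem_graph_iff]
  refine ⟨fun ⟨y, h1, h2⟩ => ⟨y, h2, ?_⟩, fun ⟨y, h1, h2⟩ => ⟨y, ?_, h1⟩⟩
  · rw [← h2]; exact eq_neg_of_add_eq_zero_right h1
  · rw [h1, h2]; exact add_neg_cancel x

/-- For closed `T` both kernels are closed, so they are Hilbert spaces and have Hilbert bases. -/
theorem isClosed_kernels {T : E →ₗ.[𝕜] E} (hT : T.IsClosed) :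
    IsClosed (kerOneSub T : Set E) ∧ IsClosed (kerOneAdd T : Set E) := by
  constructor
  · have h : (kerOneSub T : Set E) = (fun x : E => (x, x)) ⁻¹' (T.graph : Set (E × E)) :=
      Set.ext fun _ => mem_kerOneSub
    rw [h]
    exact IsClosed.preimage (by fun_prop) hT
  · have h : (kerOneAdd T : Set E) = (fun x : E => (x, -x)) ⁻¹' (T.graph : Set (E × E)) :=
      Set.ext fun _ => mem_kerOneAdd
    rw [h]
    exact IsClosed.preimage (by fun_prop) hT

/-- The deficiency index `dim ker (1 - T⋆)`. -/
noncomputable def deficiencyIndexSub [CompleteSpace E] (T : E →ₗ.[𝕜] E) : Cardinal.{u} :=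
  hilbertDim 𝕜 (kerOneSub T†)

/-- The deficiency index `dim ker (1 + T⋆)`. -/
noncomputable def deficiencyIndexAdd [CompleteSpace E] (T : E →ₗ.[𝕜] E) : Cardinal.{u} :=
  hilbertDim 𝕜 (kerOneAdd T†)

end operators

section boundary

variable {𝕜 : Type v} {E : Type u} [RCLike 𝕜] [NormedAddCommGroup E] [InnerProductSpace 𝕜 E]
  {G G₁ G₂ : Type u}
  [NormedAddCommGroup G] [InnerProductSpace 𝕜 G]
  [NormedAddCommGroup G₁] [InnerProductSpace 𝕜 G₁]
  [NormedAddCommGroup G₂] [InnerProductSpace 𝕜 G₂]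

/-- `(G, Γ₁, Γ₂)` is a boundary triplet for `T`; note that `D(-T⋆) = D(T⋆)`. -/
structure IsBoundaryTriplet [CompleteSpace E] (T : E →ₗ.[𝕜] E)
    (Γ₁ Γ₂ : T†.domain →ₗ[𝕜] G) : Prop where
  surjective : Function.Surjective fun x : T†.domain => (Γ₁ x, Γ₂ x)
  green : ∀ x y : T†.domain,
    inner 𝕜 (T† x) (y : E) + inner 𝕜 (x : E) (T† y)
      = inner 𝕜 (Γ₁ x) (Γ₂ y) + inner 𝕜 (Γ₂ x) (Γ₁ y)

/-- `(Ω, G₁, G₂, F, ω)` is a boundary system for `T`, for sesquilinear forms `Ω` on `E ⊕ E`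
and `ω` on `G₁ ⊕ G₂`. Only the vector space structure of the direct sums matters here.
The map `F` is not assumed to be linear. -/
structure IsBoundarySystem [CompleteSpace E] (T : E →ₗ.[𝕜] E)
    (Ω : E × E →ₗ⋆[𝕜] E × E →ₗ[𝕜] 𝕜) (F : T†.graph → G₁ × G₂)
    (ω : G₁ × G₂ →ₗ⋆[𝕜] G₁ × G₂ →ₗ[𝕜] 𝕜) : Prop where
  surjective : Function.Surjective F
  form_eq : ∀ x y : T†.domain,
    Ω ((x : E), T† x) ((y : E), T† y)
      = ω (F ⟨((x : E), T† x), T†.mem_graph x⟩) (F ⟨((y : E), T† y), T†.mem_graph y⟩)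

variable (𝕜 E G₁ G₂) in
/-- The standard symmetric form `Ω((x, y), (u, v)) = (x, v) + (y, u)` on `E ⊕ E`. -/
noncomputable def stdSymmForm : E × E →ₗ⋆[𝕜] E × E →ₗ[𝕜] 𝕜 :=
  LinearMap.mk₂'ₛₗ (starRingEnd 𝕜) (RingHom.id 𝕜)
    (fun p q => inner 𝕜 p.1 q.2 + inner 𝕜 p.2 q.1)
    (fun p p' q => by simp only [Prod.fst_add, Prod.snd_add, inner_add_left]; ring)
    (fun c p q => by simp only [Prod.smul_fst, Prod.smul_snd, inner_smul_left, smul_eq_mul]; ring)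
    (fun p q q' => by simp only [Prod.fst_add, Prod.snd_add, inner_add_right]; ring)
    (fun c p q => by
      simp only [Prod.smul_fst, Prod.smul_snd, inner_smul_right, smul_eq_mul, RingHom.id_apply]
      ring)

variable (𝕜 G₁ G₂) in
/-- The standard unitary form `ω((x, y), (u, v)) = (x, u) - (y, v)` on `G₁ ⊕ G₂`. -/
noncomputable def stdUnitaryForm : G₁ × G₂ →ₗ⋆[𝕜] G₁ × G₂ →ₗ[𝕜] 𝕜 :=
  LinearMap.mk₂'ₛₗ (starRingEnd 𝕜) (RingHom.id 𝕜)
    (fun p q => inner 𝕜 p.1 q.1 - inner 𝕜 p.2 q.2)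
    (fun p p' q => by simp only [Prod.fst_add, Prod.snd_add, inner_add_left]; ring)
    (fun c p q => by simp only [Prod.smul_fst, Prod.smul_snd, inner_smul_left, smul_eq_mul]; ring)
    (fun p q q' => by simp only [Prod.fst_add, Prod.snd_add, inner_add_right]; ring)
    (fun c p q => by
      simp only [Prod.smul_fst, Prod.smul_snd, inner_smul_right, smul_eq_mul, RingHom.id_apply]
      ring)

end boundary

end SkewExt

/-!
Write `T = H₀⋆`, `K₋ = ker (1 - T)`, `K₊ = ker (1 + T)`, and let
`Ω((x, y), (u, v)) = (x, v) + (y, u)` be the standard symmetric form. Everything rests on two facts.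

*Structure of `Graph T`* (`exists_decomposition_of_mem_adjoint_graph`). Since `H₀` is closed and
skew-symmetric, every element of `Graph T` is a sum `(a, -H₀ a) + (x, x) + (y, -y)` with
`a ∈ D(H₀)`, `x ∈ K₋`, `y ∈ K₊`. The first summands form the radical of `Ω` on `Graph T`, and on
the other two `Ω` is `2 (x, x') - 2 (y, y')`. So `Ω` on `Graph T` modulo its radical is the standard
unitary form on `K₋ ⊕ K₊`, up to a factor.

*Lagrangian subspaces.* Skew-self-adjointness of `H` says that `Graph H` equals its own annihilator
with respect to `Ω` (`mem_neg_adjoint_graph_iff`). A subspace of `G₁ ⊕ G₂` that is its own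
annihilator for the standard unitary form is the graph of a unitary `G₁ → G₂`
(`nonempty_linearIsometryEquiv_of_lagrangian`), and such a unitary exists iff the Hilbert dimensions
agree (`hilbertDim_eq_iff_nonempty`).

The implications are proved as the cycle (ii) → (iii) → (iv) → (i) → (ii). A unitary `K₋ → K₊` gives
a boundary triplet with values in `K₊`; a boundary triplet gives a boundary system by rotating the
hyperbolic form of the triplet into the unitary form; the preimage under `F` of the graph of a
unitary `G₁ → G₂` is Lagrangian, hence gives a skew-self-adjoint extension; and the graph of a
skew-self-adjoint extension induces a Lagrangian subspace of `K₋ ⊕ K₊`, hence a unitary `K₋ → K₊`.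
-/

namespace SkewExt

/-! ### Hilbert dimension and unitaries -/

section dim

variable {𝕜 : Type v} [RCLike 𝕜]
  {G₁ G₂ : Type u} [NormedAddCommGroup G₁] [InnerProductSpace 𝕜 G₁] [CompleteSpace G₁]
  [NormedAddCommGroup G₂] [InnerProductSpace 𝕜 G₂] [CompleteSpace G₂]

theorem hilbertDim_eq_iff_nonempty :
    hilbertDim 𝕜 G₁ = hilbertDim 𝕜 G₂ ↔ Nonempty (G₁ ≃ₗᵢ[𝕜] G₂) := by
  obtain ⟨w₁, b₁, -⟩ := exists_hilbertBasis 𝕜 G₁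
  obtain ⟨w₂, b₂, -⟩ := exists_hilbertBasis 𝕜 G₂
  constructor
  · intro h
    rw [hilbertDim_eq b₁, hilbertDim_eq b₂, Cardinal.eq] at h
    obtain ⟨e⟩ := h
    have hv : Orthonormal 𝕜 fun i => b₂ (e i) := b₂.orthonormal.comp _ e.injective
    have hs : ⊤ ≤ (Submodule.span 𝕜 (Set.range fun i => b₂ (e i))).topologicalClosure := by
      have hr : (Set.range fun i => b₂ (e i)) = Set.range b₂ := e.surjective.range_comp b₂
      rw [hr, b₂.dense_span]
    exact ⟨b₁.repr.trans (HilbertBasis.mk hv hs).repr.symm⟩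
  · rintro ⟨e⟩
    rw [hilbertDim_eq b₁, hilbertDim_eq (HilbertBasis.ofRepr (e.symm.trans b₁.repr))]

/-- The hypothesis says that `L` is its own annihilator for the standard unitary form, so that
`‖p.1‖ = ‖p.2‖` on `L`. Each coordinate projection of `L` is isometric, hence has closed range, and
a vector orthogonal to the range lies in `L` with the other coordinate `0`, so it vanishes. -/
theorem nonempty_linearIsometryEquiv_of_lagrangian (L : Submodule 𝕜 (G₁ × G₂))
    (hL : ∀ p, p ∈ L ↔ ∀ q ∈ L, inner 𝕜 q.1 p.1 = inner 𝕜 q.2 p.2) :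
    Nonempty (G₁ ≃ₗᵢ[𝕜] G₂) := by
  have hnorm : ∀ p ∈ L, ‖p.1‖ = ‖p.2‖ := by
    intro p hp
    have h := (hL p).1 hp p hp
    rw [inner_self_eq_norm_sq_to_K, inner_self_eq_norm_sq_to_K] at h
    exact (sq_eq_sq₀ (norm_nonneg _) (norm_nonneg _)).1 (by exact_mod_cast h)
  have hclosed : IsClosed (L : Set (G₁ × G₂)) := by
    have h : (L : Set (G₁ × G₂))
        = ⋂ q ∈ L, {p | inner 𝕜 q.1 p.1 = inner 𝕜 q.2 p.2} := by
      ext p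
      simp only [SetLike.mem_coe, Set.mem_iInter]
      exact hL p
    rw [h]
    exact isClosed_biInter fun q _ => isClosed_eq (by fun_prop) (by fun_prop)
  have : CompleteSpace L := hclosed.completeSpace_coe
  let f₁ : L →ₗᵢ[𝕜] G₁ :=
    ⟨(LinearMap.fst 𝕜 G₁ G₂).comp L.subtype, fun p => by
      change ‖p.1.1‖ = max ‖p.1.1‖ ‖p.1.2‖
      rw [← hnorm p p.2, max_self]⟩
  let f₂ : L →ₗᵢ[𝕜] G₂ :=
    ⟨(LinearMap.snd 𝕜 G₁ G₂).comp L.subtype, fun p => by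
      change ‖p.1.2‖ = max ‖p.1.1‖ ‖p.1.2‖
      rw [hnorm p p.2, max_self]⟩
  have hs₁ : Function.Surjective f₁ := by
    rw [← LinearIsometry.coe_toLinearMap, ← LinearMap.range_eq_top]
    have hc : IsClosed (LinearMap.range f₁.toLinearMap : Set G₁) := by
      rw [LinearMap.coe_range]
      exact f₁.isometry.isClosedEmbedding.isClosed_range
    have := hc.completeSpace_coe
    rw [← Submodule.orthogonal_eq_bot_iff, Submodule.eq_bot_iff]
    intro x hx
    have hxL : (x, (0 : G₂)) ∈ L := (hL _).2 fun q hq => by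
      rw [inner_zero_right]
      exact (Submodule.mem_orthogonal _ _).1 hx _ ⟨⟨q, hq⟩, rfl⟩
    simpa using hnorm _ hxL
  have hs₂ : Function.Surjective f₂ := by
    rw [← LinearIsometry.coe_toLinearMap, ← LinearMap.range_eq_top]
    have hc : IsClosed (LinearMap.range f₂.toLinearMap : Set G₂) := by
      rw [LinearMap.coe_range]
      exact f₂.isometry.isClosedEmbedding.isClosed_range
    have := hc.completeSpace_coe
    rw [← Submodule.orthogonal_eq_bot_iff, Submodule.eq_bot_iff]
    intro y hy
    have hyL : ((0 : G₁), y) ∈ L := (hL _).2 fun q hq => by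
      rw [inner_zero_right]
      exact ((Submodule.mem_orthogonal _ _).1 hy _ ⟨⟨q, hq⟩, rfl⟩).symm
    simpa using (hnorm _ hyL).symm
  exact ⟨(LinearIsometryEquiv.ofSurjective f₁ hs₁).symm.trans
    (LinearIsometryEquiv.ofSurjective f₂ hs₂)⟩

end dim

/-! ### The graph of the adjoint -/

section adjoint

variable {𝕜 : Type v} {E : Type u} [RCLike 𝕜] [NormedAddCommGroup E] [InnerProductSpace 𝕜 E]

theorem mem_neg_graph_iff {S : E →ₗ.[𝕜] E} {x y : E} :
    (x, y) ∈ (-S).graph ↔ (x, -y) ∈ S.graph := by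
  simp only [LinearPMap.mem_graph_iff, LinearPMap.neg_apply, LinearPMap.neg_domain,
    neg_eq_iff_eq_neg]

/-- The spaces `{(x, x)}` and `{(y, -y)}` are orthogonal for the standard symmetric form, which is
positive on the first and negative on the second. -/
theorem symmForm_kernels (x y x' y' : E) :
    inner 𝕜 (x - y) (x' + y') + inner 𝕜 (x + y) (x' - y')
      = 2 * (inner 𝕜 x x' - inner 𝕜 y y') := by
  simp only [inner_add_left, inner_add_right, inner_sub_left, inner_sub_right]
  ring

variable [CompleteSpace E] {T : E →ₗ.[𝕜] E}

theorem mem_adjoint_graph_iff (hT : Dense (T.domain : Set E)) {x y : E} :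
    (x, y) ∈ T†.graph ↔ ∀ a b, (a, b) ∈ T.graph → inner 𝕜 b x = inner 𝕜 a y := by
  simp only [LinearPMap.adjoint_graph_eq_graph_adjoint hT, Submodule.mem_adjoint_iff, sub_eq_zero]

/-- The graph of `-T⋆` is the annihilator of the graph of `T` for the standard symmetric form. -/
theorem mem_neg_adjoint_graph_iff (hT : Dense (T.domain : Set E)) {x y : E} :
    (x, y) ∈ (-T†).graph ↔ ∀ a b, (a, b) ∈ T.graph → inner 𝕜 b x + inner 𝕜 a y = 0 := by
  simp only [mem_neg_graph_iff, mem_adjoint_graph_iff hT, inner_neg_right, eq_neg_iff_add_eq_zero]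

theorem IsSkewSymmetric.mem_adjoint_graph (hs : IsSkewSymmetric T) {a b : E}
    (h : (a, b) ∈ T.graph) : (a, -b) ∈ T†.graph :=
  mem_neg_graph_iff.1 (LinearPMap.le_graph_of_le hs h)

/-- The von Neumann decomposition of the graph of `T⋆`. Projecting `(u, -v)` orthogonally onto the
graph of `T` leaves a remainder `(c, d)` with `(c, -d)` and `(d, -c)` both in the graph of `T⋆`;
half their difference and half their sum are of the form `(x, x)` and `(y, -y)`. -/
theorem exists_decomposition_of_mem_adjoint_graph (hT : Dense (T.domain : Set E))
    (hc : T.IsClosed) (hs : IsSkewSymmetric T) {u v : E} (h : (u, v) ∈ T†.graph) :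
    ∃ a b x y, (a, b) ∈ T.graph ∧ x ∈ kerOneSub T† ∧ y ∈ kerOneAdd T† ∧
      u = a + x + y ∧ v = -b + x - y := by
  let N : Submodule 𝕜 (WithLp 2 (E × E)) :=
    T.graph.comap (WithLp.linearEquiv 2 𝕜 (E × E)).toLinearMap
  have hN : IsClosed (N : Set (WithLp 2 (E × E))) :=
    IsClosed.preimage (WithLp.prod_continuous_ofLp 2 E E) hc
  have := hN.completeSpace_coe
  obtain ⟨n, hn, r, hr, hnr⟩ :=
    N.exists_add_mem_mem_orthogonal (WithLp.toLp 2 (u, -v))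
  obtain ⟨⟨a, b⟩⟩ := n
  obtain ⟨⟨c, d⟩⟩ := r
  have hab : (a, b) ∈ T.graph := hn
  have h1 : u = a + c := congrArg (fun p => (WithLp.ofLp p).1) hnr
  have h2 : -v = b + d := congrArg (fun p => (WithLp.ofLp p).2) hnr
  have hv : v = -b - d := by rw [← neg_neg v, h2]; abel
  have hcd : (c, -d) ∈ T†.graph := by
    have := T†.graph.sub_mem h (hs.mem_adjoint_graph hab)
    rwa [h1, hv, Prod.mk_sub_mk, add_sub_cancel_left,
      show -b - d - -b = -d by abel] at this
  have hdc : (d, -c) ∈ T†.graph := by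
    rw [mem_adjoint_graph_iff hT]
    intro a' b' h'
    have := (Submodule.mem_orthogonal _ _).1 hr (WithLp.toLp 2 (a', b')) h'
    rw [WithLp.prod_inner_apply] at this
    rw [inner_neg_right]
    exact eq_neg_of_add_eq_zero_right this
  have h2' : (2 : 𝕜)⁻¹ + 2⁻¹ = 1 := by norm_num
  refine ⟨a, b, (2 : 𝕜)⁻¹ • (c - d), (2 : 𝕜)⁻¹ • (c + d), hab, ?_, ?_, ?_, ?_⟩
  · have := T†.graph.smul_mem (2 : 𝕜)⁻¹ (T†.graph.sub_mem hcd hdc)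
    rwa [Prod.mk_sub_mk, Prod.smul_mk, show -d - -c = c - d by abel, ← mem_kerOneSub] at this
  · have := T†.graph.smul_mem (2 : 𝕜)⁻¹ (T†.graph.add_mem hcd hdc)
    rwa [Prod.mk_add_mk, Prod.smul_mk, show -d + -c = -(c + d) by abel, smul_neg,
      ← mem_kerOneAdd] at this
  · rw [h1, add_assoc, ← smul_add, show c - d + (c + d) = c + c by abel, smul_add, ← add_smul,
      h2', one_smul]
  · rw [hv, add_sub_assoc, ← smul_sub, show c - d - (c + d) = -d + -d by abel, smul_add,
      ← add_smul, h2', one_smul, sub_eq_add_neg]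

theorem add_sub_mem_adjoint_graph {x y : E} (hx : x ∈ kerOneSub T†) (hy : y ∈ kerOneAdd T†) :
    (x + y, x - y) ∈ T†.graph := by
  rw [mem_kerOneSub] at hx
  rw [mem_kerOneAdd] at hy
  simpa [sub_eq_add_neg] using T†.graph.add_mem hx hy

end adjoint

/-! ### Equal deficiency indices give a boundary triplet -/

section triplet

variable {𝕜 : Type v} {E : Type u} [RCLike 𝕜] [NormedAddCommGroup E] [InnerProductSpace 𝕜 E]
  [CompleteSpace E] {T : E →ₗ.[𝕜] E}

theorem completeSpace_kernels (hT : Dense (T.domain : Set E)) :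
    CompleteSpace (kerOneSub T†) ∧ CompleteSpace (kerOneAdd T†) :=
  have h := isClosed_kernels (LinearPMap.adjoint_isClosed hT)
  ⟨h.1.completeSpace_coe, h.2.completeSpace_coe⟩

/-- The map `u ↦ P₋ (u + T⋆ u)`, with `P₋` the orthogonal projection onto `ker (1 - T⋆)`. Its value
is twice the component of `(u, T⋆ u)` in `{(x, x) ; x ∈ ker (1 - T⋆)}`. -/
noncomputable def projSub (T : E →ₗ.[𝕜] E) [CompleteSpace (kerOneSub T†)] :
    T†.domain →ₗ[𝕜] kerOneSub T† :=
  (kerOneSub T†).orthogonalProjectionOnto.toLinearMap.comp (T†.domain.subtype + T†.toFun)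

/-- The map `u ↦ P₊ (u - T⋆ u)`, with `P₊` the orthogonal projection onto `ker (1 + T⋆)`. Its value
is twice the component of `(u, T⋆ u)` in `{(y, -y) ; y ∈ ker (1 + T⋆)}`. -/
noncomputable def projAdd (T : E →ₗ.[𝕜] E) [CompleteSpace (kerOneAdd T†)] :
    T†.domain →ₗ[𝕜] kerOneAdd T† :=
  (kerOneAdd T†).orthogonalProjectionOnto.toLinearMap.comp (T†.domain.subtype - T†.toFun)

theorem projSub_projAdd_eq [CompleteSpace (kerOneSub T†)] [CompleteSpace (kerOneAdd T†)]
    (hT : Dense (T.domain : Set E)) {a b : E} (hab : (a, b) ∈ T.graph)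
    (x : kerOneSub T†) (y : kerOneAdd T†) (u : T†.domain)
    (hu : (u : E) = a + x + y) (hv : T† u = -b + x - y) :
    projSub T u = (2 : 𝕜) • x ∧ projAdd T u = (2 : 𝕜) • y := by
  constructor
  · have h : a - b ∈ (kerOneSub T†)ᗮ := by
      rw [Submodule.mem_orthogonal']
      intro w hw
      rw [inner_sub_left, (mem_adjoint_graph_iff hT).1 (mem_kerOneSub.1 hw) a b hab, sub_self]
    have e : (u : E) + T† u = ((2 : 𝕜) • x : kerOneSub T†) + (a - b) := by
      rw [hu, hv, Submodule.coe_smul, two_smul]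
      abel
    change (kerOneSub T†).orthogonalProjectionOnto ((u : E) + T† u) = _
    rw [e, map_add, Submodule.orthogonalProjectionOnto_mem_subspace_eq_self,
      Submodule.orthogonalProjectionOnto_apply_of_mem_orthogonal h, add_zero]
  · have h : a + b ∈ (kerOneAdd T†)ᗮ := by
      rw [Submodule.mem_orthogonal']
      intro w hw
      rw [inner_add_left, (mem_adjoint_graph_iff hT).1 (mem_kerOneAdd.1 hw) a b hab,
        inner_neg_right, add_neg_cancel]
    have e : (u : E) - T† u = ((2 : 𝕜) • y : kerOneAdd T†) + (a + b) := by
      rw [hu, hv, Submodule.coe_smul, two_smul]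
      abel
    change (kerOneAdd T†).orthogonalProjectionOnto ((u : E) - T† u) = _
    rw [e, map_add, Submodule.orthogonalProjectionOnto_mem_subspace_eq_self,
      Submodule.orthogonalProjectionOnto_apply_of_mem_orthogonal h, add_zero]

theorem green_projSub_projAdd [CompleteSpace (kerOneSub T†)] [CompleteSpace (kerOneAdd T†)]
    (hT : Dense (T.domain : Set E)) (hc : T.IsClosed) (hs : IsSkewSymmetric T) (u u' : T†.domain) :
    inner 𝕜 (T† u) (u' : E) + inner 𝕜 (u : E) (T† u')
      = 2⁻¹ * (inner 𝕜 (projSub T u) (projSub T u') - inner 𝕜 (projAdd T u) (projAdd T u')) := by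
  obtain ⟨a, b, x, y, hab, hx, hy, hu, hv⟩ :=
    exists_decomposition_of_mem_adjoint_graph hT hc hs (T†.mem_graph u)
  obtain ⟨a', b', x', y', hab', hx', hy', hu', hv'⟩ :=
    exists_decomposition_of_mem_adjoint_graph hT hc hs (T†.mem_graph u')
  obtain ⟨e₁, e₂⟩ := projSub_projAdd_eq hT hab ⟨x, hx⟩ ⟨y, hy⟩ u hu hv
  obtain ⟨e₁', e₂'⟩ := projSub_projAdd_eq hT hab' ⟨x', hx'⟩ ⟨y', hy'⟩ u' hu' hv'
  -- `(a, -b)` annihilates the whole graph of `T⋆`, and so does `(a', -b')` on the other side.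
  have h₁ : inner 𝕜 b (u' : E) = inner 𝕜 a (T† u') :=
    (mem_adjoint_graph_iff hT).1 (T†.mem_graph u') a b hab
  have h₂ : inner 𝕜 (x + y) b' = inner 𝕜 (x - y) a' := by
    rw [← inner_conj_symm, (mem_adjoint_graph_iff hT).1 (add_sub_mem_adjoint_graph hx hy) a' b' hab',
      inner_conj_symm]
  have key : inner 𝕜 (T† u) (u' : E) + inner 𝕜 (u : E) (T† u')
      = inner 𝕜 (x - y) (x' + y') + inner 𝕜 (x + y) (x' - y') := by
    calc inner 𝕜 (T† u) (u' : E) + inner 𝕜 (u : E) (T† u')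
        = inner 𝕜 (-b + (x - y)) (u' : E) + inner 𝕜 (a + (x + y)) (T† u') := by
          rw [← add_assoc, ← hu, ← add_sub_assoc, ← hv]
      _ = inner 𝕜 (x - y) (u' : E) + inner 𝕜 (x + y) (T† u') := by
          rw [inner_add_left, inner_add_left, inner_neg_left, h₁]
          ring
      _ = inner 𝕜 (x - y) (a' + (x' + y')) + inner 𝕜 (x + y) (-b' + (x' - y')) := by
          rw [← add_assoc, ← hu', ← add_sub_assoc, ← hv']
      _ = _ := by
          rw [inner_add_right, inner_add_right (x + y), inner_neg_right, h₂]
          ring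
  rw [key, symmForm_kernels, e₁, e₂, e₁', e₂']
  simp only [inner_smul_left, inner_smul_right, Submodule.coe_inner, map_ofNat]
  ring

theorem projSub_projAdd_surjective [CompleteSpace (kerOneSub T†)] [CompleteSpace (kerOneAdd T†)]
    (hT : Dense (T.domain : Set E)) (x : kerOneSub T†) (y : kerOneAdd T†) :
    ∃ u, projSub T u = x ∧ projAdd T u = y := by
  obtain ⟨u, hu, hv⟩ := LinearPMap.mem_graph_iff _ |>.1
    (add_sub_mem_adjoint_graph ((2 : 𝕜)⁻¹ • x).2 ((2 : 𝕜)⁻¹ • y).2)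
  have := projSub_projAdd_eq hT (T.graph.zero_mem : (0, 0) ∈ T.graph)
    ((2 : 𝕜)⁻¹ • x) ((2 : 𝕜)⁻¹ • y) u (by rw [hu, zero_add]) (by rw [hv, neg_zero, zero_add])
  exact ⟨u, by rw [this.1, smul_inv_smul₀ two_ne_zero], by rw [this.2, smul_inv_smul₀ two_ne_zero]⟩

theorem exists_boundaryTriplet_of_deficiencyIndex_eq (hT : Dense (T.domain : Set E))
    (hc : T.IsClosed) (hs : IsSkewSymmetric T)
    (h : deficiencyIndexSub T = deficiencyIndexAdd T) :
    ∃ (G : Type u) (_ : NormedAddCommGroup G) (_ : InnerProductSpace 𝕜 G) (_ : CompleteSpace G)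
      (Γ₁ Γ₂ : T†.domain →ₗ[𝕜] G), IsBoundaryTriplet T Γ₁ Γ₂ := by
  obtain ⟨_, _⟩ := completeSpace_kernels hT
  obtain ⟨V⟩ := hilbertDim_eq_iff_nonempty.1 h
  let A : T†.domain →ₗ[𝕜] kerOneAdd T† := V.toLinearEquiv.toLinearMap.comp (projSub T)
  refine ⟨kerOneAdd T†, inferInstance, inferInstance, inferInstance,
    (2 : 𝕜)⁻¹ • (A + projAdd T), (2 : 𝕜)⁻¹ • (A - projAdd T), ?_, ?_⟩
  · rintro ⟨g₁, g₂⟩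
    obtain ⟨u, hx, hy⟩ := projSub_projAdd_surjective hT (V.symm (g₁ + g₂)) (g₁ - g₂)
    have hA : A u = g₁ + g₂ := by
      change V (projSub T u) = _
      rw [hx, V.apply_symm_apply]
    refine ⟨u, ?_⟩
    simp only [LinearMap.smul_apply, LinearMap.add_apply, LinearMap.sub_apply, hA, hy]
    rw [show g₁ + g₂ + (g₁ - g₂) = (2 : 𝕜) • g₁ by rw [two_smul]; abel,
      show g₁ + g₂ - (g₁ - g₂) = (2 : 𝕜) • g₂ by rw [two_smul]; abel,
      inv_smul_smul₀ two_ne_zero, inv_smul_smul₀ two_ne_zero]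
  · intro u u'
    have hA : inner 𝕜 (A u) (A u') = inner 𝕜 (projSub T u) (projSub T u') :=
      V.inner_map_map _ _
    rw [green_projSub_projAdd hT hc hs, ← hA]
    simp only [LinearMap.smul_apply, LinearMap.add_apply, LinearMap.sub_apply, inner_smul_left,
      inner_smul_right, inner_add_left, inner_add_right, inner_sub_left, inner_sub_right,
      map_inv₀, map_ofNat]
    ring

end triplet

/-! ### A boundary triplet gives a boundary system -/

section system

variable {𝕜 : Type v} {E : Type u} [RCLike 𝕜] [NormedAddCommGroup E] [InnerProductSpace 𝕜 E]

theorem stdSymmForm_apply (p q : E × E) :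
    stdSymmForm 𝕜 E p q = inner 𝕜 p.1 q.2 + inner 𝕜 p.2 q.1 := rfl

theorem stdUnitaryForm_apply {G₁ G₂ : Type u} [NormedAddCommGroup G₁] [InnerProductSpace 𝕜 G₁]
    [NormedAddCommGroup G₂] [InnerProductSpace 𝕜 G₂] (p q : G₁ × G₂) :
    stdUnitaryForm 𝕜 G₁ G₂ p q = inner 𝕜 p.1 q.1 - inner 𝕜 p.2 q.2 := rfl

variable [CompleteSpace E] {T : E →ₗ.[𝕜] E}
  {G : Type u} [NormedAddCommGroup G] [InnerProductSpace 𝕜 G]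

/-- The map `F = (Γ₁ + Γ₂ / 2, Γ₁ - Γ₂ / 2)` diagonalizes the form
`(Γ₁ x, Γ₂ y) + (Γ₂ x, Γ₁ y)`. -/
theorem IsBoundaryTriplet.exists_isBoundarySystem {Γ₁ Γ₂ : T†.domain →ₗ[𝕜] G}
    (h : IsBoundaryTriplet T Γ₁ Γ₂) :
    ∃ F : T†.graph → G × G,
      IsBoundarySystem T (stdSymmForm 𝕜 E) F (stdUnitaryForm 𝕜 G G) := by
  let π : T†.graph → T†.domain := fun p =>
    ⟨p.1.1, LinearPMap.mem_domain_of_mem_graph (y := p.1.2) p.2⟩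
  refine ⟨fun p => (Γ₁ (π p) + (2 : 𝕜)⁻¹ • Γ₂ (π p), Γ₁ (π p) - (2 : 𝕜)⁻¹ • Γ₂ (π p)), ?_, ?_⟩
  · rintro ⟨g₁, g₂⟩
    obtain ⟨u, hu⟩ := h.surjective ((2 : 𝕜)⁻¹ • (g₁ + g₂), g₁ - g₂)
    obtain ⟨h₁, h₂⟩ := Prod.mk.inj hu
    refine ⟨⟨((u : E), T† u), T†.mem_graph u⟩, ?_⟩
    change (Γ₁ u + (2 : 𝕜)⁻¹ • Γ₂ u, Γ₁ u - (2 : 𝕜)⁻¹ • Γ₂ u) = _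
    rw [h₁, h₂, ← smul_add, ← smul_sub,
      show g₁ + g₂ + (g₁ - g₂) = (2 : 𝕜) • g₁ by rw [two_smul]; abel,
      show g₁ + g₂ - (g₁ - g₂) = (2 : 𝕜) • g₂ by rw [two_smul]; abel,
      inv_smul_smul₀ two_ne_zero, inv_smul_smul₀ two_ne_zero]
  · intro u u'
    rw [stdSymmForm_apply, stdUnitaryForm_apply, add_comm, h.green]
    change _ = inner 𝕜 (Γ₁ u + (2 : 𝕜)⁻¹ • Γ₂ u) (Γ₁ u' + (2 : 𝕜)⁻¹ • Γ₂ u')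
      - inner 𝕜 (Γ₁ u - (2 : 𝕜)⁻¹ • Γ₂ u) (Γ₁ u' - (2 : 𝕜)⁻¹ • Γ₂ u')
    simp only [inner_smul_left, inner_smul_right, inner_add_left, inner_add_right, inner_sub_left,
      inner_sub_right, map_inv₀, map_ofNat]
    ring

end system

/-! ### A boundary system gives a skew-self-adjoint extension -/

section extension

variable {𝕜 : Type v} {E : Type u} [RCLike 𝕜] [NormedAddCommGroup E] [InnerProductSpace 𝕜 E]
  [CompleteSpace E] {T : E →ₗ.[𝕜] E}
  {G₁ G₂ : Type u} [NormedAddCommGroup G₁] [InnerProductSpace 𝕜 G₁]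
  [NormedAddCommGroup G₂] [InnerProductSpace 𝕜 G₂]

theorem IsBoundarySystem.form_graph_eq {F : T†.graph → G₁ × G₂}
    (hF : IsBoundarySystem T (stdSymmForm 𝕜 E) F (stdUnitaryForm 𝕜 G₁ G₂)) (p q : T†.graph) :
    inner 𝕜 p.1.1 q.1.2 + inner 𝕜 p.1.2 q.1.1
      = inner 𝕜 (F p).1 (F q).1 - inner 𝕜 (F p).2 (F q).2 := by
  obtain ⟨⟨x, x'⟩, hx⟩ := p
  obtain ⟨⟨y, y'⟩, hy⟩ := q
  obtain ⟨u, rfl, rfl⟩ := (LinearPMap.mem_graph_iff _).1 hx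
  obtain ⟨w, rfl, rfl⟩ := (LinearPMap.mem_graph_iff _).1 hy
  exact hF.form_eq u w

/-- The preimage under `F` of the graph of a unitary is its own annihilator in the graph
of `T⋆`. -/
theorem IsBoundarySystem.map_fst_eq_snd_iff {F : T†.graph → G₁ × G₂}
    (hF : IsBoundarySystem T (stdSymmForm 𝕜 E) F (stdUnitaryForm 𝕜 G₁ G₂)) (V : G₁ ≃ₗᵢ[𝕜] G₂)
    (q : T†.graph) :
    V (F q).1 = (F q).2 ↔ ∀ r : T†.graph, V (F r).1 = (F r).2 →
      inner 𝕜 r.1.1 q.1.2 + inner 𝕜 r.1.2 q.1.1 = 0 := by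
  constructor
  · intro hq r hr
    rw [hF.form_graph_eq, ← hq, ← hr, V.inner_map_map, sub_self]
  · intro h
    obtain ⟨r, hr⟩ := hF.surjective
      ((F q).1 - V.symm (F q).2, V ((F q).1 - V.symm (F q).2))
    have h0 := h r (by rw [hr])
    -- With `g = (F q).1 - V⁻¹ (F q).2` the form evaluates to `(g, g)`.
    rw [hF.form_graph_eq, hr, ← V.apply_symm_apply (F q).2, V.inner_map_map,
      V.symm_apply_apply, ← inner_sub_right, inner_self_eq_zero, sub_eq_zero] at h0
    rw [h0, V.apply_symm_apply]

/-- Since `F` need not be linear, the Lagrangian subspace is written as an annihilator, which makes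
linearity evident. The sign in the second coordinate accounts for `H ⊆ -T⋆`. -/
theorem IsBoundarySystem.exists_isSkewSelfAdjoint (hT : Dense (T.domain : Set E))
    (hs : IsSkewSymmetric T) {F : T†.graph → G₁ × G₂}
    (hF : IsBoundarySystem T (stdSymmForm 𝕜 E) F (stdUnitaryForm 𝕜 G₁ G₂)) (V : G₁ ≃ₗᵢ[𝕜] G₂) :
    ∃ H : E →ₗ.[𝕜] E, T ≤ H ∧ IsSkewSelfAdjoint H := by
  let L : Submodule 𝕜 (E × E) :=
    { carrier := {p | (p.1, -p.2) ∈ T†.graph ∧ ∀ r : T†.graph, V (F r).1 = (F r).2 →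
        inner 𝕜 r.1.1 (-p.2) + inner 𝕜 r.1.2 p.1 = 0}
      zero_mem' := ⟨by simp, fun r _ => by simp⟩
      add_mem' := by
        rintro p q ⟨hp, hp'⟩ ⟨hq, hq'⟩
        refine ⟨by simpa [add_comm] using T†.graph.add_mem hp hq, fun r hr => ?_⟩
        have h₁ := hp' r hr
        have h₂ := hq' r hr
        simp only [Prod.fst_add, Prod.snd_add, neg_add, inner_add_right]
        linear_combination h₁ + h₂
      smul_mem' := by
        rintro c p ⟨hp, hp'⟩
        refine ⟨by simpa using T†.graph.smul_mem c hp, fun r hr => ?_⟩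
        have h₁ := hp' r hr
        simp only [Prod.smul_fst, Prod.smul_snd, ← smul_neg, inner_smul_right]
        linear_combination c * h₁ }
  have hLmem : ∀ q : T†.graph, V (F q).1 = (F q).2 ↔ (q.1.1, -q.1.2) ∈ L := by
    intro q
    rw [hF.map_fst_eq_snd_iff]
    refine ⟨fun h => ⟨by simp, fun r hr => ?_⟩, fun h r hr => ?_⟩
    · simpa using h r hr
    · simpa using h.2 r hr
  have hgraph : L.toLinearPMap.graph = L := by
    refine Submodule.toLinearPMap_graph_eq _ fun p hp h0 => ?_
    have := T†.graph_fst_eq_zero_snd hp.1 h0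
    simpa using this
  have hTL : T.graph ≤ L := by
    rintro ⟨a, b⟩ hab
    refine ⟨hs.mem_adjoint_graph hab, fun r _ => ?_⟩
    have h : inner 𝕜 b r.1.1 = inner 𝕜 a r.1.2 := (mem_adjoint_graph_iff hT).1 r.2 a b hab
    rw [inner_neg_right, ← inner_conj_symm, h, inner_conj_symm, neg_add_cancel]
  have hle : T ≤ L.toLinearPMap := LinearPMap.le_of_le_graph (hgraph.symm ▸ hTL)
  have hd : Dense (L.toLinearPMap.domain : Set E) := hT.mono hle.1
  refine ⟨L.toLinearPMap, hle, hd, LinearPMap.eq_of_eq_graph ?_⟩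
  ext ⟨x, y⟩
  rw [mem_neg_adjoint_graph_iff hd, hgraph]
  constructor
  · rintro ⟨-, hp⟩ a b ⟨hab, hab'⟩
    have h := hp ⟨(a, -b), hab⟩ ((hLmem _).2 (by simpa using ⟨hab, hab'⟩))
    simp only [inner_neg_right, inner_neg_left] at h
    linear_combination -h
  · intro h
    refine ⟨?_, fun r hr => ?_⟩
    · rw [← mem_neg_graph_iff, mem_neg_adjoint_graph_iff hT]
      exact fun a b hab => h a b (hTL hab)
    · have := h _ _ ((hLmem r).1 hr)
      simp only [inner_neg_right, inner_neg_left] at this ⊢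
      linear_combination -this

end extension

/-! ### A skew-self-adjoint extension forces equal deficiency indices -/

section deficiency

variable {𝕜 : Type v} {E : Type u} [RCLike 𝕜] [NormedAddCommGroup E] [InnerProductSpace 𝕜 E]
  [CompleteSpace E] {T : E →ₗ.[𝕜] E}

theorem deficiencyIndex_eq_of_isSkewSelfAdjoint (hT : Dense (T.domain : Set E))
    (hc : T.IsClosed) (hs : IsSkewSymmetric T) {H : E →ₗ.[𝕜] E} (hTH : T ≤ H)
    (hH : IsSkewSelfAdjoint H) : deficiencyIndexSub T = deficiencyIndexAdd T := by
  obtain ⟨_, _⟩ := completeSpace_kernels hT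
  refine hilbertDim_eq_iff_nonempty.2 ?_
  obtain ⟨hd, hH⟩ := hH
  have hlag : ∀ x y, (x, y) ∈ H.graph ↔
      ∀ a b, (a, b) ∈ H.graph → inner 𝕜 b x + inner 𝕜 a y = 0 := by
    intro x y
    conv_lhs => rw [hH]
    exact mem_neg_adjoint_graph_iff hd
  have hTH' := LinearPMap.le_graph_of_le hTH
  have hHT : ∀ {x y}, (x, y) ∈ H.graph → (x, -y) ∈ T†.graph := by
    intro x y h
    rw [← mem_neg_graph_iff, mem_neg_adjoint_graph_iff hT]
    exact fun a b hab => (hlag x y).1 h a b (hTH' hab)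
  -- The trace of the graph of `-H` on `K₋ ⊕ K₊`.
  let L : Submodule 𝕜 (kerOneSub T† × kerOneAdd T†) :=
    { carrier := {p | ((p.1 : E) + p.2, (p.2 : E) - p.1) ∈ H.graph}
      zero_mem' := by
        have := H.graph.zero_mem
        rw [Prod.zero_eq_mk] at this
        simpa only [Set.mem_ofPred_eq, Prod.fst_zero, Prod.snd_zero, Submodule.coe_zero, add_zero,
          sub_zero] using this
      add_mem' := by
        intro p q hp hq
        have := H.graph.add_mem hp hq
        rwa [Prod.mk_add_mk, add_add_add_comm, sub_add_sub_comm] at this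
      smul_mem' := by
        intro c p hp
        have := H.graph.smul_mem c hp
        rwa [Prod.smul_mk, smul_add, smul_sub] at this }
  refine nonempty_linearIsometryEquiv_of_lagrangian L fun p => ?_
  have hform : ∀ q : kerOneSub T† × kerOneAdd T†,
      inner 𝕜 ((q.2 : E) - q.1) ((p.1 : E) + p.2) + inner 𝕜 ((q.1 : E) + q.2) ((p.2 : E) - p.1) = 0
        ↔ inner 𝕜 q.1 p.1 = inner 𝕜 q.2 p.2 := by
    intro q
    have e := symmForm_kernels (𝕜 := 𝕜) (q.1 : E) q.2 p.1 p.2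
    rw [← neg_sub (q.1 : E), ← neg_sub (p.1 : E), inner_neg_left, inner_neg_right, ← neg_add, e,
      neg_eq_zero, mul_eq_zero, or_iff_right two_ne_zero, sub_eq_zero, Submodule.coe_inner,
      Submodule.coe_inner]
  constructor
  · intro hp q hq
    exact (hform q).1 ((hlag _ _).1 hp _ _ hq)
  · intro h
    refine (hlag _ _).2 fun a b hab => ?_
    -- Modulo the graph of `T`, which annihilates `p`, the vector `(a, b)` lies in `L`.
    obtain ⟨a₀, b₀, x, y, h₀, hx, hy, ha, hb⟩ :=
      exists_decomposition_of_mem_adjoint_graph hT hc hs (hHT hab)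
    have ha' : a = a₀ + (x + y) := by rw [ha, add_assoc]
    have hb' : b = b₀ + (y - x) := by rw [← neg_neg b, hb]; abel
    have hmem : (x + y, y - x) ∈ H.graph := by
      have := H.graph.sub_mem hab (hTH' h₀)
      rwa [ha', hb', Prod.mk_sub_mk, add_sub_cancel_left, add_sub_cancel_left] at this
    have h₁ := (hform (⟨x, hx⟩, ⟨y, hy⟩)).2 (h (⟨x, hx⟩, ⟨y, hy⟩) hmem)
    have h₂ := (mem_adjoint_graph_iff hT).1 (add_sub_mem_adjoint_graph p.1.2 p.2.2) a₀ b₀ h₀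
    rw [← neg_sub (p.2 : E), inner_neg_right] at h₂
    rw [ha', hb', inner_add_left, inner_add_left a₀]
    linear_combination h₁ + h₂

end deficiency

end SkewExt

theorem mainTheorem5 {𝕜 : Type v} [RCLike 𝕜] {𝓗 : Type u} [NormedAddCommGroup 𝓗]
    [InnerProductSpace 𝕜 𝓗] [CompleteSpace 𝓗] (H₀ : 𝓗 →ₗ.[𝕜] 𝓗)
    (h_dense : Dense (H₀.domain : Set 𝓗)) (h_closed : H₀.IsClosed)
    (h_skew : SkewExt.IsSkewSymmetric H₀) :
    List.TFAE [
      ∃ H : 𝓗 →ₗ.[𝕜] 𝓗, H₀ ≤ H ∧ SkewExt.IsSkewSelfAdjoint H,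
      SkewExt.deficiencyIndexSub H₀ = SkewExt.deficiencyIndexAdd H₀,
      ∃ (G : Type u) (_ : NormedAddCommGroup G) (_ : InnerProductSpace 𝕜 G) (_ : CompleteSpace G)
        (Γ₁ Γ₂ : H₀†.domain →ₗ[𝕜] G), SkewExt.IsBoundaryTriplet H₀ Γ₁ Γ₂,
      ∃ (G₁ : Type u) (_ : NormedAddCommGroup G₁) (_ : InnerProductSpace 𝕜 G₁)
        (_ : CompleteSpace G₁) (G₂ : Type u) (_ : NormedAddCommGroup G₂)
        (_ : InnerProductSpace 𝕜 G₂) (_ : CompleteSpace G₂) (F : H₀†.graph → G₁ × G₂),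
        SkewExt.IsBoundarySystem H₀ (SkewExt.stdSymmForm 𝕜 𝓗) F
            (SkewExt.stdUnitaryForm 𝕜 G₁ G₂) ∧
          SkewExt.hilbertDim 𝕜 G₁ = SkewExt.hilbertDim 𝕜 G₂] := by
  tfae_have 2 → 3 := SkewExt.exists_boundaryTriplet_of_deficiencyIndex_eq h_dense h_closed h_skew
  tfae_have 3 → 4 := by
    rintro ⟨G, _, _, _, Γ₁, Γ₂, h⟩
    obtain ⟨F, hF⟩ := h.exists_isBoundarySystem
    exact ⟨G, inferInstance, inferInstance, inferInstance, G, inferInstance, inferInstance,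
      inferInstance, F, hF, rfl⟩
  tfae_have 4 → 1 := by
    rintro ⟨G₁, _, _, _, G₂, _, _, _, F, hF, hdim⟩
    obtain ⟨V⟩ := SkewExt.hilbertDim_eq_iff_nonempty.1 hdim
    exact hF.exists_isSkewSelfAdjoint h_dense h_skew V
  tfae_have 1 → 2 := by
    rintro ⟨H, hle, hH⟩
    exact SkewExt.deficiencyIndex_eq_of_isSkewSelfAdjoint h_dense h_closed h_skew hle hH
  tfae_finish
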